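/- Let $\mathcal H(\mathbb C)$ be the complex Fréchet space of entire functions $f:\mathbb C\to\mathbb C$ with the topology of uniform convergence on compact subsets of $\mathbb C$, and for $a\in\mathbb C$ let $T_a$ be the continuous linear translation operator on $\mathcal H(\mathbb C)$ given by $T_af(z)=f(z-a)$. A vector $f\in\mathcal H(\mathbb C)$ is called hypercyclic for a continuous linear operator $T$ on $\mathcal H(\mathbb C)$ if its orbit $\{T^nf:n=0,1,2,\dots\}$ is dense in $\mathcal H(\mathbb C)$. Then the set of all $f\in\mathcal H(\mathbb C)$ that are hypercyclic for every operator $bT_a$ with $a,b\in\mathbb C\setminus\{0\}$ is a dense $G_\delta$-subset of $\mathcal H(\mathbb C)$. -/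

import Mathlib

/-- The elements `x` that are universal for a family of maps `F i : X → Y`: those whose orbit
`{F i x : i}` is dense in `Y`. -/
def universalElements {ι X Y : Type*} [TopologicalSpace Y] (F : ι → X → Y) : Set X :=
  {x | Dense (Set.range fun i => F i x)}

/-- The hypercyclic vectors of a continuous linear operator `T`: the universal elements for the
family of powers `T ^ n`, `n = 0, 1, 2, …`. -/
def hypercyclicVectors {𝕜 X : Type*} [Semiring 𝕜] [AddCommMonoid X] [Module 𝕜 X]
    [TopologicalSpace X] (T : X →L[𝕜] X) : Set X :=
  universalElements fun n : ℕ => ⇑(T ^ n)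

/-- The vectors that are hypercyclic for every member of a family of operators. -/
def commonHypercyclicVectors {𝕜 X A : Type*} [Semiring 𝕜] [AddCommMonoid X] [Module 𝕜 X]
    [TopologicalSpace X] (T : A → X →L[𝕜] X) : Set X :=
  ⋂ a, hypercyclicVectors (T a)

/-- The entire functions, as a complex vector subspace of `C(ℂ, ℂ)`. -/
def entireFunctions : Submodule ℂ C(ℂ, ℂ) where
  carrier := {f | Differentiable ℂ f}
  add_mem' := fun hf hg => Differentiable.add hf hg
  zero_mem' := differentiable_const (0 : ℂ)
  smul_mem' := fun c _ hf => Differentiable.const_smul hf c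

/-- The space of entire functions. It carries the topology induced by the compact-open topology
of `C(ℂ, ℂ)`, that is, the topology of uniform convergence on compact subsets of `ℂ`. -/
abbrev EntireSpace : Type := ↥entireFunctions

/-- The translation operator `(T_a f)(z) = f (z - a)` as a continuous linear operator on the space
of entire functions. -/
noncomputable def translation (a : ℂ) : EntireSpace →L[ℂ] EntireSpace where
  toFun f := ⟨f.1.comp ⟨fun z => z - a, by fun_prop⟩,
    (show Differentiable ℂ f.1 from f.2).comp (differentiable_id.sub_const a)⟩
  map_add' _ _ := rfl
  map_smul' _ _ := rfl
  cont := ((ContinuousMap.continuous_precomp _).comp continuous_subtype_val).subtype_mk _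

/-! The common hypercyclic vectors are a countable intersection, over nonempty basic open sets `V`
and compact parameter sets `quadrantParameters`, of sets of `f` whose orbit under every `b T_a` in
the compact set meets `V`. These sets are open by joint continuity and compactness, so by Baire it
is enough that each is dense.

Since `(b T_a)^n f (z) = b^n f (z - n a)`, Runge approximation on disjoint discs
(`exists_entire_approx_on_closedBalls`) yields an `f` close to a given `f₀` near `0` and close to `c
g(z - w)` near finitely many far away points `w`. Density follows if every `(a, b)` in the compact
set has some `n` and `(w, c)` with `w + n a ≈ 0` and `b^n c ≈ 1`. This is `exists_separated_cover`.

Write `a = u p (1 + σ i)`. At distance `X`, both `σ` and `log ‖b‖ / p` must be known to accuracy of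
order `1 / X`. The slopes are spread over boundedly many transverse segments, each long enough for
separated points. The growth rates use successive blocks at distances `X i` growing linearly: their
cells, of length proportional to `1 / X i`, cover any interval because the harmonic series diverges.
The remaining parameters, `p` and the phase of `b`, need only boundedly many offsets, whatever `X`
is, by `exists_hitting_sequence`. -/

/-! ### Runge approximation on disjoint closed discs -/

theorem isPreconnected_annulus (w : ℂ) (r R : ℝ) (hr : 0 ≤ r) :
    IsPreconnected (Metric.ball w R \ Metric.closedBall w r) := by
  have h : Metric.ball w R \ Metric.closedBall w r =
      (fun p : ℝ × ℝ => w + p.1 * Complex.exp (p.2 * Complex.I)) '' (Set.Ioo r R ×ˢ Set.univ) := by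
    ext z
    simp only [Set.mem_sdiff, Metric.mem_ball, Metric.mem_closedBall, not_le, Set.mem_image,
      Set.mem_prod, Set.mem_Ioo, Set.mem_univ, and_true, Prod.exists, dist_eq_norm]
    constructor
    · rintro ⟨h1, h2⟩
      exact ⟨‖z - w‖, (z - w).arg, ⟨h2, h1⟩, by rw [Complex.norm_mul_exp_arg_mul_I]; ring⟩
    · rintro ⟨s, t, ⟨h1, h2⟩, rfl⟩
      have : ‖w + s * Complex.exp (t * Complex.I) - w‖ = s := by
        rw [add_sub_cancel_left, norm_mul, Complex.norm_exp_ofReal_mul_I, mul_one,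
          Complex.norm_real, Real.norm_of_nonneg (hr.trans h1.le)]
      rw [this]
      exact ⟨h2, h1⟩
  rw [h]
  exact (isPreconnected_Ioo.prod isPreconnected_univ).image _ (by fun_prop)

/-- The annulus around the disc is connected, hence lies on one side of any separation of the
difference. Filling the disc into that side would separate `U`. -/
theorem IsPreconnected.diff_closedBall {U : Set ℂ} (hU : IsPreconnected U) {w : ℂ} {r R : ℝ}
    (hr : 0 ≤ r) (hrR : r < R) (hw : Metric.ball w R ⊆ U) :
    IsPreconnected (U \ Metric.closedBall w r) := by
  have key : ∀ S T : Set ℂ, IsOpen S → IsOpen T → U \ Metric.closedBall w r ⊆ S ∪ T →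
      ((U \ Metric.closedBall w r) ∩ S).Nonempty → ((U \ Metric.closedBall w r) ∩ T).Nonempty →
      Metric.ball w R \ Metric.closedBall w r ⊆ S →
      ((U \ Metric.closedBall w r) ∩ (S ∩ T)).Nonempty := by
    rintro S T hS hT hST ⟨x, hx, hxS⟩ ⟨y, hy, hyT⟩ hring
    obtain ⟨z, hzU, hz1, hz2⟩ := hU (S ∪ Metric.ball w R) (T \ Metric.closedBall w r)
      (hS.union Metric.isOpen_ball) (hT.sdiff Metric.isClosed_closedBall)
      (fun z hz => by
        by_cases h : z ∈ Metric.closedBall w r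
        · exact Or.inl (Or.inr (Metric.closedBall_subset_ball hrR h))
        · exact (hST ⟨hz, h⟩).imp Or.inl fun h' => ⟨h', h⟩)
      ⟨x, hx.1, Or.inl hxS⟩ ⟨y, hy.1, hyT, hy.2⟩
    exact ⟨z, ⟨hzU, hz2.2⟩, hz1.elim id fun h => hring ⟨h, hz2.2⟩, hz2.1⟩
  intro S T hS hT hST hneS hneT
  by_contra hcon
  have hsub : Metric.ball w R \ Metric.closedBall w r ⊆ U \ Metric.closedBall w r :=
    Set.sdiff_subset_sdiff_left hw
  rcases (isPreconnected_iff_subset_of_disjoint.1 (isPreconnected_annulus w r R hr)) S T hS hT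
    (hsub.trans hST) (by
      rw [← Set.not_nonempty_iff_eq_empty]
      exact fun h => hcon (h.mono (Set.inter_subset_inter_left _ hsub))) with h | h
  · exact hcon (key S T hS hT hST hneS hneT h)
  · exact hcon (by
      rw [Set.inter_comm S T]
      exact key T S hT hS (by rwa [Set.union_comm]) hneT hneS h)

theorem exists_gt_forall_add_lt_dist {ι : Type*} (s : Finset ι) {w : ι → ℂ} {r : ι → ℝ} {i : ι}
    (h : ∀ j ∈ s, j ≠ i → r i + r j < dist (w i) (w j)) :
    ∃ R > r i, ∀ j ∈ s, j ≠ i → R + r j < dist (w i) (w j) := by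
  have h1 : ∀ᶠ R in nhdsWithin (r i) (Set.Ioi (r i)),
      ∀ j ∈ s, j ≠ i → R + r j < dist (w i) (w j) := by
    rw [Filter.eventually_all_finset]
    intro j hj
    by_cases hji : j = i
    · simp [hji]
    · have : Filter.Tendsto (fun R => R + r j) (nhdsWithin (r i) (Set.Ioi (r i)))
          (nhds (r i + r j)) :=
        ((continuous_id.add continuous_const).tendsto (r i)).mono_left nhdsWithin_le_nhds
      filter_upwards [this.eventually (gt_mem_nhds (h j hj hji))] with R hR _ using hR
  obtain ⟨R, hR, hR'⟩ := (h1.and self_mem_nhdsWithin).exists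
  exact ⟨R, hR', hR⟩

theorem isPreconnected_compl_biUnion_closedBall {ι : Type*} (s : Finset ι) (w : ι → ℂ) (r : ι → ℝ)
    (hr : ∀ i ∈ s, 0 ≤ r i)
    (h : ∀ i ∈ s, ∀ j ∈ s, i ≠ j → r i + r j < dist (w i) (w j)) :
    IsPreconnected (⋃ i ∈ s, Metric.closedBall (w i) (r i))ᶜ := by
  classical
  induction s using Finset.induction_on with
  | empty => simpa using isPreconnected_univ
  | insert i s hi ih =>
    have h1 := ih (fun j hj => hr j (Finset.mem_insert_of_mem hj)) fun j hj k hk =>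
      h j (Finset.mem_insert_of_mem hj) k (Finset.mem_insert_of_mem hk)
    obtain ⟨R, hR, hR'⟩ := exists_gt_forall_add_lt_dist (w := w) (r := r) (i := i) s
      fun j hj hji => h i (Finset.mem_insert_self _ _) j (Finset.mem_insert_of_mem hj) hji.symm
    have h2 : (⋃ j ∈ insert i s, Metric.closedBall (w j) (r j))ᶜ =
        (⋃ j ∈ s, Metric.closedBall (w j) (r j))ᶜ \ Metric.closedBall (w i) (r i) := by
      ext z
      simp [and_comm]
    rw [h2]
    refine h1.diff_closedBall (hr i (Finset.mem_insert_self _ _)) hR fun z hz hz' => ?_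
    simp only [Set.mem_iUnion, Metric.mem_closedBall, exists_prop] at hz'
    obtain ⟨j, hj, hzj⟩ := hz'
    have h3 := hR' j hj (fun hji => hi (hji ▸ hj))
    have h4 := dist_triangle_left (w i) (w j) z
    rw [Metric.mem_ball] at hz
    linarith

/-- The restrictions of entire functions to a set. -/
def entireRestrictions (K : Set ℂ) : Subalgebra ℂ C(K, ℂ) where
  carrier := {f | ∃ g : ℂ → ℂ, Differentiable ℂ g ∧ ∀ z : K, f z = g z}
  mul_mem' := by
    rintro f₁ f₂ ⟨g₁, h₁, e₁⟩ ⟨g₂, h₂, e₂⟩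
    exact ⟨g₁ * g₂, h₁.mul h₂, fun z => by simp [e₁, e₂]⟩
  add_mem' := by
    rintro f₁ f₂ ⟨g₁, h₁, e₁⟩ ⟨g₂, h₂, e₂⟩
    exact ⟨g₁ + g₂, h₁.add h₂, fun z => by simp [e₁, e₂]⟩
  algebraMap_mem' c := ⟨fun _ => c, differentiable_const c, fun _ => rfl⟩

/-- Passing from `C(K, ℂ)` to the closed subalgebra generated by entire functions can only fill
holes of a spectrum. The spectrum of `(z - w) / R` has connected complement, so it is unchanged, and
spectral mapping makes `1 - y ^ N` invertible inside the subalgebra. -/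
theorem exists_entire_approx_inv_one_sub_pow {K : Set ℂ} (hK : IsCompact K)
    (hconn : IsPreconnected Kᶜ) (w : ℂ) {R : ℝ} (hR : 0 < R) (hwR : ∀ z ∈ K, dist z w ≠ R)
    (N : ℕ) (hN : N ≠ 0) {ε : ℝ} (hε : 0 < ε) :
    ∃ g : ℂ → ℂ, Differentiable ℂ g ∧ ∀ z ∈ K, ‖g z - (1 - ((z - w) / R) ^ N)⁻¹‖ < ε := by
  have : CompactSpace K := isCompact_iff_compactSpace.1 hK
  let A := (entireRestrictions K).topologicalClosure
  have hA : IsClosed (A : Set C(K, ℂ)) := Subalgebra.isClosed_topologicalClosure _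
  have : CompleteSpace A := hA.completeSpace_coe
  let y : A := ⟨⟨fun z : K => ((z : ℂ) - w) / R, by fun_prop⟩,
    Subalgebra.le_topologicalClosure _ ⟨fun z => (z - w) / R, by fun_prop, fun _ => rfl⟩⟩
  have hsp : spectrum ℂ (y : C(K, ℂ)) = (fun z : ℂ => (z - w) / R) '' K := by
    rw [ContinuousMap.spectrum_eq_range]
    ext c
    simp [y]
  have hRc : (R : ℂ) ≠ 0 := by exact_mod_cast hR.ne'
  have hsp' : spectrum ℂ y = (fun z : ℂ => (z - w) / R) '' K := by
    rw [← hsp]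
    refine Subalgebra.spectrum_eq_of_isPreconnected_compl A y ?_
    have : (spectrum ℂ (y : C(K, ℂ)))ᶜ = (fun z : ℂ => (z - w) / R) '' Kᶜ := by
      rw [hsp, Set.image_compl_eq]
      refine ⟨fun a b hab => ?_, fun c => ⟨c * R + w, by field_simp; ring⟩⟩
      simpa [div_left_inj' hRc] using hab
    rw [this]
    exact hconn.image _ (by fun_prop)
  have hunit : IsUnit (1 - y ^ N) := by
    have h1 : (1 : ℂ) ∉ spectrum ℂ (y ^ N) := by
      rw [spectrum.map_pow_of_pos y (Nat.pos_of_ne_zero hN), hsp']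
      rintro ⟨_, ⟨z, hz, rfl⟩, h⟩
      have h2 : ‖(z - w) / R‖ = 1 := by
        have := congrArg norm h
        simp only [norm_pow, norm_one] at this
        exact (pow_eq_one_iff_of_nonneg (norm_nonneg _) hN).1 this
      rw [norm_div, Complex.norm_real, Real.norm_of_nonneg hR.le, div_eq_one_iff_eq hR.ne'] at h2
      exact hwR z hz (by rw [dist_eq_norm, h2])
    rw [spectrum.notMem_iff] at h1
    simpa using h1
  obtain ⟨u, hu⟩ := hunit
  have hval : ∀ z : K, ((↑u⁻¹ : A) : C(K, ℂ)) z = (1 - (((z : ℂ) - w) / R) ^ N)⁻¹ := by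
    intro z
    have h1 : (↑u⁻¹ : A) * (1 - y ^ N) = 1 := by rw [← hu]; simp
    have h2 := congrArg (fun f : A => (f : C(K, ℂ)) z) h1
    refine eq_inv_of_mul_eq_one_left ?_
    simpa [y] using h2
  have hmem : ((↑u⁻¹ : A) : C(K, ℂ)) ∈ closure ((entireRestrictions K : Set C(K, ℂ))) := by
    rw [← Subalgebra.topologicalClosure_coe]
    exact (↑u⁻¹ : A).2
  obtain ⟨f, ⟨g, hg, hfg⟩, hf⟩ := Metric.mem_closure_iff.1 hmem ε hε
  refine ⟨g, hg, fun z hz => ?_⟩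
  have h1 := (ContinuousMap.dist_lt_iff hε).1 hf ⟨z, hz⟩
  rw [hval, hfg, dist_comm, dist_eq_norm] at h1
  exact h1

/-- With a circle of radius `R` about `w i` separating disc `i` from the others, `(1 - ((z - w i) /
R) ^ N)⁻¹` tends uniformly to `1` on disc `i` and to `0` on the others as `N → ∞`. -/
theorem exists_entire_approx_indicator {ι : Type*} (s : Finset ι) (w : ι → ℂ) (r : ι → ℝ)
    (hr : ∀ i ∈ s, 0 ≤ r i) (h : ∀ i ∈ s, ∀ j ∈ s, i ≠ j → r i + r j < dist (w i) (w j))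
    {i : ι} (hi : i ∈ s) {ε : ℝ} (hε : 0 < ε) :
    ∃ u : ℂ → ℂ, Differentiable ℂ u ∧ (∀ z ∈ Metric.closedBall (w i) (r i), ‖u z - 1‖ < ε) ∧
      ∀ j ∈ s, j ≠ i → ∀ z ∈ Metric.closedBall (w j) (r j), ‖u z‖ < ε := by
  obtain ⟨R₂, hR₂, hR₂'⟩ := exists_gt_forall_add_lt_dist (w := w) (r := r) (i := i) s
      fun j hj hji => h i hi j hj hji.symm
  obtain ⟨R, hR, hRR₂⟩ := exists_between hR₂
  have hR0 : 0 < R := (hr i hi).trans_lt hR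
  have hR1 : r i / R < 1 := (div_lt_one hR0).2 hR
  have hR3 : 1 < R₂ / R := (one_lt_div hR0).2 hRR₂
  have hri : 0 ≤ r i / R := div_nonneg (hr i hi) hR0.le
  have hfar : ∀ j ∈ s, j ≠ i → ∀ z ∈ Metric.closedBall (w j) (r j), R₂ ≤ dist z (w i) := by
    intro j hj hji z hz
    have h1 := hR₂' j hj hji
    have h2 := dist_triangle_left (w i) (w j) z
    rw [Metric.mem_closedBall] at hz
    linarith
  have hlim1 : Filter.Tendsto (fun N : ℕ => (r i / R) ^ N / (1 - (r i / R) ^ N)) Filter.atTop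
      (nhds 0) := by
    have h1 := tendsto_pow_atTop_nhds_zero_of_lt_one hri hR1
    have h2 := h1.div (tendsto_const_nhds (x := (1 : ℝ)).sub h1) (by norm_num)
    rw [sub_zero, zero_div] at h2
    exact h2
  have hlim2 : Filter.Tendsto (fun N : ℕ => ((R₂ / R) ^ N - 1)⁻¹) Filter.atTop (nhds 0) :=
    ((Filter.tendsto_atTop_add_const_right _ (-1) (tendsto_pow_atTop_atTop_of_one_lt hR3))
      ).inv_tendsto_atTop
  obtain ⟨N, ⟨hN1, hN2⟩, hN0⟩ := (((hlim1.eventually (gt_mem_nhds (half_pos hε))).and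
    (hlim2.eventually (gt_mem_nhds (half_pos hε)))).and (Filter.eventually_ne_atTop 0)).exists
  obtain ⟨g, hg, hgK⟩ := exists_entire_approx_inv_one_sub_pow
    (K := ⋃ j ∈ s, Metric.closedBall (w j) (r j))
    (s.isCompact_biUnion fun j _ => isCompact_closedBall _ _)
    (isPreconnected_compl_biUnion_closedBall s w r hr h) (w i) hR0 (by
      intro z hz
      simp only [Set.mem_iUnion, exists_prop] at hz
      obtain ⟨j, hj, hz⟩ := hz
      by_cases hji : j = i
      · subst hji
        rw [Metric.mem_closedBall] at hz
        exact (hz.trans_lt hR).ne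
      · exact (hRR₂.trans_le (hfar j hj hji z hz)).ne') N hN0 (half_pos hε)
  refine ⟨g, hg, fun z hz => ?_, fun j hj hji z hz => ?_⟩
  · have h1 := hgK z (Set.mem_biUnion hi hz)
    set x := ((z - w i) / R) ^ N with hx
    have h2 : ‖x‖ ≤ (r i / R) ^ N := by
      rw [hx, norm_pow, norm_div, Complex.norm_real, Real.norm_of_nonneg hR0.le, ← dist_eq_norm]
      exact pow_le_pow_left₀ (by positivity)
        (div_le_div_of_nonneg_right (Metric.mem_closedBall.1 hz) hR0.le) N
    have h3 : (r i / R) ^ N < 1 := pow_lt_one₀ hri hR1 hN0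
    have h4 : 1 - (r i / R) ^ N ≤ ‖1 - x‖ := by
      have := norm_sub_norm_le (1 : ℂ) x
      rw [norm_one] at this
      linarith
    have h5 : (1 : ℂ) - x ≠ 0 := norm_pos_iff.1 (by linarith)
    have h6 : ‖(1 - x)⁻¹ - 1‖ ≤ (r i / R) ^ N / (1 - (r i / R) ^ N) := by
      have : (1 - x)⁻¹ - 1 = x / (1 - x) := by field_simp; ring
      rw [this, norm_div]
      exact div_le_div₀ (by positivity) h2 (by linarith) h4
    calc ‖g z - 1‖ = ‖(g z - (1 - x)⁻¹) + ((1 - x)⁻¹ - 1)‖ := by ring_nf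
      _ ≤ _ := norm_add_le _ _
      _ < ε := by linarith
  · have h1 := hgK z (Set.mem_biUnion hj hz)
    set x := ((z - w i) / R) ^ N with hx
    have h2 : (R₂ / R) ^ N ≤ ‖x‖ := by
      rw [hx, norm_pow, norm_div, Complex.norm_real, Real.norm_of_nonneg hR0.le, ← dist_eq_norm]
      exact pow_le_pow_left₀ (by positivity)
        (div_le_div_of_nonneg_right (hfar j hj hji z hz) hR0.le) N
    have h3 : 1 < (R₂ / R) ^ N := one_lt_pow₀ hR3 hN0
    have h4 : (R₂ / R) ^ N - 1 ≤ ‖1 - x‖ := by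
      have := norm_sub_norm_le x 1
      rw [norm_one, norm_sub_rev] at this
      linarith
    have h6 : ‖(1 - x)⁻¹‖ ≤ ((R₂ / R) ^ N - 1)⁻¹ := by
      rw [norm_inv]
      exact inv_anti₀ (by linarith) h4
    calc ‖g z‖ = ‖(g z - (1 - x)⁻¹) + (1 - x)⁻¹‖ := by ring_nf
      _ ≤ _ := norm_add_le _ _
      _ < ε := by linarith

/-- Runge approximation on a finite family of disjoint closed discs. -/
theorem exists_entire_approx_on_closedBalls {ι : Type*} (s : Finset ι) (w : ι → ℂ) (r : ι → ℝ)
    (hr : ∀ i ∈ s, 0 ≤ r i) (h : ∀ i ∈ s, ∀ j ∈ s, i ≠ j → r i + r j < dist (w i) (w j))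
    (g : ι → ℂ → ℂ) (hg : ∀ i ∈ s, Differentiable ℂ (g i)) {ε : ℝ} (hε : 0 < ε) :
    ∃ f : ℂ → ℂ, Differentiable ℂ f ∧
      ∀ i ∈ s, ∀ z ∈ Metric.closedBall (w i) (r i), ‖f z - g i z‖ < ε := by
  classical
  let K := ⋃ j ∈ s, Metric.closedBall (w j) (r j)
  have hK : IsCompact K := s.isCompact_biUnion fun j _ => isCompact_closedBall _ _
  have hb : ∃ M > 0, ∀ i ∈ s, ∀ z ∈ K, ‖g i z‖ ≤ M := by
    have h1 : ∀ i ∈ s, ∃ M, ∀ z ∈ K, ‖g i z‖ ≤ M := fun i hi =>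
      hK.exists_bound_of_continuousOn (hg i hi).continuous.continuousOn
    choose! M hM using h1
    refine ⟨∑ i ∈ s, |M i| + 1, by positivity, fun i hi z hz => ?_⟩
    have := Finset.single_le_sum (f := fun i => |M i|) (fun j _ => abs_nonneg _) hi
    have h2 := hM i hi z hz
    have h3 := le_abs_self (M i)
    linarith
  obtain ⟨M, hM, hMg⟩ := hb
  -- The final error is a sum of `s.card` terms of size at most `M * η`; the `+ 1` makes the bound
  -- strict.
  set η := ε / (M * (s.card + 1)) with hη
  have hη0 : 0 < η := by positivity
  have h1 : ∀ i ∈ s, ∃ u : ℂ → ℂ, Differentiable ℂ u ∧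
      (∀ z ∈ Metric.closedBall (w i) (r i), ‖u z - 1‖ < η) ∧
      ∀ j ∈ s, j ≠ i → ∀ z ∈ Metric.closedBall (w j) (r j), ‖u z‖ < η := fun i hi =>
    exists_entire_approx_indicator s w r hr h hi hη0
  choose! u hu hu1 hu0 using h1
  refine ⟨fun z => ∑ i ∈ s, g i z * u i z,
    Differentiable.fun_sum fun i hi => (hg i hi).mul (hu i hi), fun i hi z hz => ?_⟩
  have hzK : z ∈ K := Set.mem_biUnion hi hz
  have h2 : ∑ j ∈ s, g j z * u j z - g i z
      = ∑ j ∈ s, g j z * (u j z - if j = i then 1 else 0) := by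
    simp [mul_sub, Finset.sum_sub_distrib, hi]
  have h3 : ∀ j ∈ s, ‖g j z * (u j z - if j = i then 1 else 0)‖ ≤ M * η := by
    intro j hj
    rw [norm_mul]
    refine mul_le_mul (hMg j hj z hzK) ?_ (norm_nonneg _) hM.le
    split_ifs with hji
    · subst hji
      exact (hu1 j hj z hz).le
    · rw [sub_zero]
      exact (hu0 j hj i hi (Ne.symm hji) z hz).le
  rw [h2]
  refine (norm_sum_le_of_le _ h3).trans_lt ?_
  rw [Finset.sum_const, nsmul_eq_mul, hη]
  have : (s.card : ℝ) * (M * (ε / (M * (s.card + 1)))) = ε * (s.card / (s.card + 1)) := by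
    field_simp
  rw [this]
  exact mul_lt_of_lt_one_right hε ((div_lt_one (by positivity)).2 (by linarith))

/-! ### Uniform recurrence and hitting sequences -/

/-- Simultaneous Dirichlet approximation, uniformly on the product of the circles `ℝ / ℤ` and
`{v : ‖v‖ = 1}`. -/
theorem exists_uniform_return {ε : ℝ} (hε : 0 < ε) :
    ∃ Q : ℕ, ∀ (x : ℝ) (v : ℂ), ‖v‖ = 1 →
      ∃ q : ℕ, 0 < q ∧ q ≤ Q ∧ (∃ k : ℤ, |q * x - k| < ε) ∧ ‖v ^ q - 1‖ < ε := by
  have hS : IsCompact (Set.Icc (0 : ℝ) 1 ×ˢ Metric.sphere (0 : ℂ) 1) :=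
    isCompact_Icc.prod (isCompact_sphere _ _)
  obtain ⟨t, -, htf, htS⟩ := hS.finite_cover_balls (half_pos hε)
  lift t to Finset (ℝ × ℂ) using htf
  refine ⟨t.card, fun x v hv => ?_⟩
  have h1 : ∀ n : ℕ, ∃ y ∈ t, (Int.fract (n * x), v ^ n) ∈ Metric.ball y (ε / 2) := by
    intro n
    have h : (Int.fract (n * x), v ^ n) ∈ Set.Icc (0 : ℝ) 1 ×ˢ Metric.sphere (0 : ℂ) 1 :=
      ⟨⟨Int.fract_nonneg _, (Int.fract_lt_one _).le⟩, by simp [hv]⟩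
    simpa using htS h
  choose y hyt hy using h1
  -- Pigeonhole: two of the exponents `0, …, t.card` fall in the same ball, and their difference is
  -- the return time.
  obtain ⟨a, ha, b, hb, hab, heq⟩ := Finset.exists_ne_map_eq_of_card_lt_of_maps_to
    (s := Finset.range (t.card + 1)) (t := t) (f := y) (by simp) (fun n _ => hyt n)
  wlog hlt : a < b generalizing a b
  · exact this b hb a ha hab.symm heq.symm (lt_of_le_of_ne (not_lt.1 hlt) hab.symm)
  have h2 : dist (Int.fract (b * x), v ^ b) (Int.fract (a * x), v ^ a) < ε := by
    have h3 := hy a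
    have h4 := hy b
    rw [Metric.mem_ball] at h3 h4
    rw [heq] at h3
    exact (dist_triangle_right _ _ (y b)).trans_lt (by linarith)
  rw [Prod.dist_eq, max_lt_iff] at h2
  obtain ⟨h3, h4⟩ := h2
  refine ⟨b - a, Nat.sub_pos_of_lt hlt, ?_, ⟨⌊(b : ℝ) * x⌋ - ⌊(a : ℝ) * x⌋, ?_⟩, ?_⟩
  · rw [Finset.mem_range] at hb
    omega
  · rw [Real.dist_eq, Int.fract, Int.fract] at h3
    rw [Nat.cast_sub hlt.le]
    push_cast
    have h5 : (b - a : ℝ) * x - (⌊(b : ℝ) * x⌋ - ⌊(a : ℝ) * x⌋) =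
        b * x - ⌊(b : ℝ) * x⌋ - (a * x - ⌊(a : ℝ) * x⌋) := by ring
    rwa [h5]
  · have h5 : v ^ b - v ^ a = v ^ a * (v ^ (b - a) - 1) := by
      rw [mul_sub, ← pow_add, Nat.add_sub_cancel' hlt.le, mul_one]
    rw [dist_eq_norm] at h4
    simp only [h5, norm_mul, norm_pow, hv, one_pow, one_mul] at h4
    exact h4

/-- There are finitely many well separated offsets `τ j` with phases `ω j` such that every pair
`(p, v)` with `‖v‖ = 1` satisfies `n p ≈ X + τ j` and `v ^ n ≈ (ω j)⁻¹` for some `n` and `j`,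
whatever the starting point `X`. -/
theorem exists_hitting_sequence {p₀ p₁ δ D : ℝ} (hp₀ : 0 < p₀) (hp : p₀ ≤ p₁) (hδ : 0 < δ)
    (hD : 0 < D) :
    ∃ (J : ℕ) (τ : ℕ → ℝ) (ω : ℕ → ℂ), (∀ j, 0 ≤ τ j) ∧ (∀ j, ‖ω j‖ = 1) ∧
      (∀ i j, i ≠ j → D ≤ |τ i - τ j|) ∧
      ∀ p ∈ Set.Icc p₀ p₁, ∀ v : ℂ, ‖v‖ = 1 → ∀ X : ℝ, 0 ≤ X →
        ∃ j < J, ∃ n : ℕ, |n * p - X - τ j| < δ ∧ ‖v ^ n * ω j - 1‖ < δ := by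
  have hp₁ : 0 < p₁ := hp₀.trans_le hp
  have hS : IsCompact (Set.Icc (0 : ℝ) p₁ ×ˢ Metric.sphere (0 : ℂ) 1) :=
    isCompact_Icc.prod (isCompact_sphere _ _)
  obtain ⟨t, htsub, htf, htS⟩ := hS.finite_cover_balls (half_pos hδ)
  lift t to Finset (ℝ × ℂ) using htf
  set M := t.card with hMdef
  have hM : 0 < M := by
    rw [hMdef, Finset.card_pos]
    have h : ((0 : ℝ), (1 : ℂ)) ∈ Set.Icc (0 : ℝ) p₁ ×ˢ Metric.sphere (0 : ℂ) 1 :=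
      ⟨⟨le_rfl, hp₁.le⟩, by simp⟩
    obtain ⟨y, hy, -⟩ := Set.mem_iUnion₂.1 (htS h)
    exact ⟨y, hy⟩
  let e := t.equivFin.symm
  let net : ℕ → ℝ × ℂ := fun m => e ⟨m % M, Nat.mod_lt _ hM⟩
  have hnet : ∀ m, net m ∈ Set.Icc (0 : ℝ) p₁ ×ˢ Metric.sphere (0 : ℂ) 1 := fun m =>
    htsub (e ⟨m % M, Nat.mod_lt _ hM⟩).2
  have hnorm : ∀ m, ‖(net m).2‖ = 1 := fun m => by simpa using (hnet m).2
  -- Each block of length `D'` holds one offset in its initial segment of length `p₁`, leaving a gap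
  -- of `D`.
  set D' := D + p₁ with hD'
  have hD'0 : 0 < D' := by positivity
  -- The first bound forces `k > 0`; the other two keep the drift in position and in phase below `δ
  -- / 2` after up to `2 ^ M` returns.
  set ε := min (p₀ / D') (min (δ / (2 * 2 ^ M * D')) (δ / (2 * 2 ^ M))) with hε
  have hε0 : 0 < ε := by positivity
  have hε1 : ε * D' ≤ p₀ := (le_div_iff₀ hD'0).1 (min_le_left _ _)
  have hε2 : 2 ^ M * (ε * D') ≤ δ / 2 := by
    have : ε ≤ δ / (2 * 2 ^ M * D') := (min_le_right _ _).trans (min_le_left _ _)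
    rw [le_div_iff₀ (by positivity)] at this
    linarith
  have hε3 : 2 ^ M * ε ≤ δ / 2 := by
    have : ε ≤ δ / (2 * 2 ^ M) := (min_le_right _ _).trans (min_le_right _ _)
    rw [le_div_iff₀ (by positivity)] at this
    linarith
  obtain ⟨Q, hQ⟩ := exists_uniform_return hε0
  obtain ⟨K, hK⟩ := exists_nat_gt (Q * p₁ / D' + ε)
  -- Block `j` carries the net point indexed by the 2-adic valuation of `j` modulo `M`. Doubling `j`
  -- advances to the next net point, so for any `k ≠ 0` the blocks `2 ^ d * k` with `d < M` run
  -- through the whole net.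
  refine ⟨2 ^ M * K + 1, fun j => j * D' + (net (padicValNat 2 j)).1,
    fun j => ((net (padicValNat 2 j)).2)⁻¹, fun j => ?_, fun j => ?_, fun i j hij => ?_, ?_⟩
  · have := (hnet (padicValNat 2 j)).1.1
    positivity
  · simp [hnorm]
  · have h1 := (hnet (padicValNat 2 i)).1
    have h2 := (hnet (padicValNat 2 j)).1
    rcases lt_or_gt_of_ne hij with h | h
    · have h3 : (i : ℝ) + 1 ≤ j := by exact_mod_cast h
      rw [le_abs]
      right
      nlinarith [h1.1, h1.2, h2.1, h2.2]
    · have h3 : (j : ℝ) + 1 ≤ i := by exact_mod_cast h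
      rw [le_abs]
      left
      nlinarith [h1.1, h1.2, h2.1, h2.2]
  rintro p ⟨hpl, hpr⟩ v hv X hX
  have hp0 : 0 < p := hp₀.trans_le hpl
  obtain ⟨q, hq0, hqQ, ⟨k, hk⟩, hvq⟩ := hQ (p / D') v hv
  have hk' : |q * p - k * D'| < ε * D' := by
    have : q * p - k * D' = (q * (p / D') - k) * D' := by field_simp
    rw [this, abs_mul, abs_of_pos hD'0]
    exact mul_lt_mul_of_pos_right hk hD'0
  have hq1 : (1 : ℝ) ≤ q := by exact_mod_cast hq0
  have hkpos : 0 < k := by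
    have h1 : 0 < (k : ℝ) * D' := by
      have := (abs_lt.1 hk').2
      nlinarith
    exact_mod_cast pos_of_mul_pos_left h1 hD'0.le
  lift k to ℕ using hkpos.le
  have hkne : k ≠ 0 := by
    rintro rfl
    simp at hkpos
  have hkK : k ≤ K := by
    have h1 := (abs_lt.1 hk).1
    have h2 : (q : ℝ) * (p / D') ≤ Q * p₁ / D' := by
      rw [mul_div_assoc]
      have : (q : ℝ) ≤ Q := by exact_mod_cast hqQ
      gcongr
    have h3 : ((k : ℕ) : ℝ) < K := by
      push_cast at h1
      linarith
    exact_mod_cast h3.le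
  -- The overshoot and phase at the first multiple of `p` beyond `X` select the net point `y`; then
  -- `2 ^ d` returns of length `q` carry them, nearly unchanged, to block `2 ^ d * k`.
  set n₀ := ⌈X / p⌉₊ with hn₀
  have hs0 : 0 ≤ n₀ * p - X := by
    have := Nat.le_ceil (X / p)
    rw [div_le_iff₀ hp0] at this
    linarith
  have hs1 : n₀ * p - X ≤ p₁ := by
    have := (Nat.ceil_lt_add_one (div_nonneg hX hp0.le)).le
    rw [← hn₀, ← sub_le_iff_le_add, le_div_iff₀ hp0] at this
    linarith
  have hmem : ((n₀ * p - X, v ^ n₀) : ℝ × ℂ) ∈ Set.Icc (0 : ℝ) p₁ ×ˢ Metric.sphere (0 : ℂ) 1 :=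
    ⟨⟨hs0, hs1⟩, by simp [hv]⟩
  obtain ⟨y, hyt, hy⟩ := Set.mem_iUnion₂.1 (htS hmem)
  set μ := t.equivFin ⟨y, hyt⟩ with hμ
  set ν := padicValNat 2 k with hν
  -- As `(M - 1) * ν ≡ -ν` modulo `M`, this solves `d + ν ≡ μ`.
  set d := (μ + (M - 1) * ν) % M with hd
  have hdM : d < M := Nat.mod_lt _ hM
  have hcolor : net (padicValNat 2 (2 ^ d * k)) = y := by
    have h1 : padicValNat 2 (2 ^ d * k) = d + ν := by
      rw [padicValNat.mul (by positivity) hkne, padicValNat.prime_pow]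
    have h2 : (d + ν) % M = μ := by
      rw [hd, Nat.mod_add_mod, add_assoc, ← Nat.succ_mul, Nat.succ_eq_add_one,
        Nat.sub_add_cancel hM, Nat.add_mul_mod_self_left]
      exact Nat.mod_eq_of_lt μ.2
    have h3 : (⟨(d + ν) % M, Nat.mod_lt _ hM⟩ : Fin M) = μ := Fin.ext h2
    simp only [net, e, h1]
    rw [h3, hμ]
    simp
  rw [Metric.mem_ball, Prod.dist_eq, max_lt_iff] at hy
  obtain ⟨hy1, hy2⟩ := hy
  have hynorm : ‖y.2‖ = 1 := by rw [← hcolor]; exact hnorm _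
  have hyne : y.2 ≠ 0 := norm_ne_zero_iff.1 (by rw [hynorm]; exact one_ne_zero)
  have h2d : (2 : ℝ) ^ d ≤ 2 ^ M := pow_le_pow_right₀ one_le_two hdM.le
  refine ⟨2 ^ d * k, ?_, n₀ + 2 ^ d * q, ?_, ?_⟩
  · exact Nat.lt_succ_of_le
      (Nat.mul_le_mul (Nat.pow_le_pow_right two_pos hdM.le) hkK)
  · simp only [hcolor]
    rw [Real.dist_eq] at hy1
    have h1 : ((n₀ + 2 ^ d * q : ℕ) : ℝ) * p - X - (((2 ^ d * k : ℕ) : ℝ) * D' + y.1) =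
        (n₀ * p - X - y.1) + 2 ^ d * (q * p - (k : ℝ) * D') := by
      push_cast
      ring
    rw [h1]
    refine (abs_add_le _ _).trans_lt ?_
    rw [abs_mul, abs_of_pos (by positivity : (0 : ℝ) < 2 ^ d)]
    have h2 : (2 : ℝ) ^ d * |q * p - (k : ℝ) * D'| ≤ 2 ^ M * (ε * D') :=
      mul_le_mul h2d (by exact_mod_cast hk'.le) (abs_nonneg _) (by positivity)
    linarith
  · simp only [hcolor]
    have h1 : v ^ (n₀ + 2 ^ d * q) * y.2⁻¹ - 1 =
        v ^ n₀ * y.2⁻¹ * ((v ^ q) ^ 2 ^ d - 1) + (v ^ n₀ - y.2) * y.2⁻¹ := by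
      rw [pow_add, mul_comm (2 ^ d) q, pow_mul]
      field_simp
      ring
    have h2 : ‖(v ^ q) ^ 2 ^ d - 1‖ ≤ 2 ^ d * ε := by
      have h3 : ∀ n : ℕ, ‖(v ^ q) ^ n - 1‖ ≤ n * ε := by
        intro n
        induction n with
        | zero => simp
        | succ n ih =>
          have : (v ^ q) ^ (n + 1) - 1 = (v ^ q) ^ n * (v ^ q - 1) + ((v ^ q) ^ n - 1) := by ring
          rw [this]
          refine (norm_add_le _ _).trans ?_
          rw [norm_mul, norm_pow, norm_pow, hv, one_pow, one_pow, one_mul]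
          push_cast
          linarith
      simpa using h3 (2 ^ d)
    rw [h1]
    refine (norm_add_le _ _).trans_lt ?_
    rw [dist_eq_norm] at hy2
    simp only [norm_mul, norm_pow, norm_inv, hv, hynorm, one_pow, inv_one, mul_one, one_mul]
    have h3 : (2 : ℝ) ^ d * ε ≤ 2 ^ M * ε := mul_le_mul_of_nonneg_right h2d hε0.le
    linarith

/-! ### Separated points serving a compact set of parameters -/

theorem not_summable_inv_add_mul {X H : ℝ} (hX : 0 < X) (hH : 0 < H) :
    ¬ Summable fun i : ℕ => (X + i * H)⁻¹ := by
  intro h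
  have h1 : Summable fun i : ℕ => (X + H) * (X + i * H)⁻¹ := h.mul_left _
  have h2 : Summable fun i : ℕ => (((i + 1 : ℕ) : ℝ))⁻¹ := by
    refine h1.of_nonneg_of_le (fun i => by positivity) fun i => ?_
    rw [← div_eq_mul_inv, le_div_iff₀ (by positivity), inv_mul_le_iff₀ (by positivity)]
    push_cast
    have : (0 : ℝ) ≤ i := Nat.cast_nonneg i
    nlinarith
  exact Real.not_summable_natCast_inv
    ((summable_nat_add_iff (f := fun n : ℕ => ((n : ℝ))⁻¹) 1).1 h2)

theorem exists_le_lt_succ {α : Type*} [LinearOrder α] (c : ℕ → α) {x : α} (h₀ : c 0 ≤ x) {I : ℕ}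
    (hI : x < c I) : ∃ i < I, c i ≤ x ∧ x < c (i + 1) := by
  induction I with
  | zero => exact absurd hI (not_lt.2 h₀)
  | succ I ih =>
    by_cases h : x < c I
    · obtain ⟨i, hi, h'⟩ := ih h
      exact ⟨i, by omega, h'⟩
    · exact ⟨I, by omega, not_lt.1 h, hI⟩

theorem norm_mul_exp_sub_one_le {E : ℝ} (hE : |E| ≤ 1) {y : ℂ} (hy : ‖y‖ = 1) :
    ‖(Real.exp E : ℂ) * y - 1‖ ≤ 2 * |E| + ‖y - 1‖ := by
  have h1 : (Real.exp E : ℂ) * y - 1 = ((Real.exp E - 1 : ℝ) : ℂ) * y + (y - 1) := by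
    push_cast
    ring
  rw [h1]
  refine (norm_add_le _ _).trans ?_
  rw [norm_mul, hy, mul_one, Complex.norm_real, Real.norm_eq_abs]
  have := Real.abs_exp_sub_one_le hE
  linarith

/-- A finite family of well separated points `w` with weights `c` such that all the parameters
`(a, b)` in a compact quadrant satisfy `n a ≈ -w` and `b ^ n c ≈ 1` for some member of the family
and some `n`. -/
theorem exists_separated_cover {u : ℂ} (hu : ‖u‖ = 1) {p₀ p₁ Λ δ D : ℝ} (R₀ : ℝ) (hp₀ : 0 < p₀)
    (hp : p₀ ≤ p₁) (hΛ : 0 ≤ Λ) (hδ : 0 < δ) (hδ1 : δ ≤ 1) (hD : 0 < D) :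
    ∃ s : Finset (ℂ × ℂ), (∀ x ∈ s, R₀ ≤ ‖x.1‖) ∧ (∀ x ∈ s, x.2 ≠ 0) ∧
      (∀ x ∈ s, ∀ y ∈ s, x ≠ y → D ≤ dist x.1 y.1) ∧
      ∀ p ∈ Set.Icc p₀ p₁, ∀ σ ∈ Set.Icc (-1 : ℝ) 1, ∀ b : ℂ, b ≠ 0 → |Real.log ‖b‖| ≤ Λ →
        ∃ x ∈ s, ∃ n : ℕ, ‖x.1 + n * (u * (p * (1 + σ * Complex.I)))‖ < δ ∧
          ‖b ^ n * x.2 - 1‖ < δ := by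
  classical
  set B := Λ / p₀ with hB
  have hB0 : 0 ≤ B := by positivity
  -- Makes both `δ₁` and `δ₁ * B` at most `δ / 16`, the latter because a position error is
  -- multiplied by the growth rate.
  set δ₁ := δ / (16 * (B + 1)) with hδ₁
  have hδ₁0 : 0 < δ₁ := by positivity
  have hδ₁B : δ₁ * (B + 1) = δ / 16 := by rw [hδ₁]; field_simp
  have hδ₁' : δ₁ ≤ δ / 16 := by nlinarith
  obtain ⟨J, τ, ω, hτ0, hω, hτ, hhit⟩ := exists_hitting_sequence hp₀ hp hδ₁0 hD
  obtain ⟨L, hL⟩ : ∃ L > 0, ∀ j < J, τ j + D ≤ L := by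
    refine ⟨∑ j ∈ Finset.range J, τ j + D,
      add_pos_of_nonneg_of_pos (Finset.sum_nonneg fun j _ => hτ0 j) hD, fun j hj => ?_⟩
    have := Finset.single_le_sum (f := τ) (fun j _ => hτ0 j) (Finset.mem_range.2 hj)
    linarith
  obtain ⟨hL0, hL⟩ := hL
  -- Slope indices differing by at least `m` give points `D` apart on the same transverse line; the
  -- residues modulo `m` are sent to different radial sub-blocks of length `L`.
  obtain ⟨m, hm⟩ := exists_nat_gt (D / (δ / 8))
  have hm0' : (0 : ℝ) < m := lt_trans (by positivity) hm
  have hm0 : 0 < m := by exact_mod_cast hm0'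
  have hmD : D ≤ m * (δ / 8) := ((div_lt_iff₀ (by positivity)).1 hm).le
  -- With `m * L ≤ X₀`, block `i` stays within `[X i, 2 * X i]`.
  set X₀ := max R₀ (m * L) with hX₀
  have hX₀R : R₀ ≤ X₀ := le_max_left _ _
  have hX₀L : m * L ≤ X₀ := le_max_right _ _
  have hX₀0 : 0 < X₀ := lt_of_lt_of_le (by positivity) hX₀L
  set X : ℕ → ℝ := fun i => X₀ + i * (m * L) with hXdef
  have hX0 : ∀ i, X₀ ≤ X i := fun i => le_add_of_nonneg_right (by positivity)
  have hXpos : ∀ i, 0 < X i := fun i => hX₀0.trans_le (hX0 i)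
  have hXmono : Monotone X := fun i j hij => by
    have : (i : ℝ) ≤ j := by exact_mod_cast hij
    simp only [hXdef]
    gcongr
  -- Block `i` serves the growth rates in `[c i, c (i + 1))`; since the cell lengths have divergent
  -- sum, finitely many cells cover `[-B, B]`.
  set c : ℕ → ℝ := fun i => -B + ∑ i' ∈ Finset.range i, δ / 16 * (X i')⁻¹ with hc
  have hcsucc : ∀ i, c (i + 1) = c i + δ / 16 * (X i)⁻¹ := fun i => by
    simp only [hc, Finset.sum_range_succ]
    ring
  obtain ⟨I, hI⟩ : ∃ I, B < c I := by
    have h1 : ¬ Summable fun i => δ / 16 * (X i)⁻¹ := by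
      rw [summable_mul_left_iff (by positivity)]
      exact not_summable_inv_add_mul hX₀0 (by positivity)
    rw [not_summable_iff_tendsto_nat_atTop_of_nonneg
      (fun i => mul_nonneg (by positivity) (inv_nonneg.2 (hXpos i).le))] at h1
    exact ((Filter.tendsto_atTop_add_const_left _ (-B) h1).eventually_gt_atTop B).exists
  set K := ⌈2 * X I / (δ / 8)⌉₊ + 1 with hK
  let x : ℕ × ℕ × ℕ → ℝ := fun q => X₀ + ((q.1 * m + q.2.1 % m : ℕ) : ℝ) * L + τ q.2.2
  let ς : ℕ × ℕ × ℕ → ℝ := fun q => -1 + q.2.1 * (δ / 8) / X q.1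
  let W : ℕ × ℕ × ℕ → ℂ × ℂ := fun q =>
    (-(u * (x q * (1 + ς q * Complex.I))), Real.exp (-(c q.1 * x q)) * ω q.2.2)
  have hxX : ∀ q, X q.1 ≤ x q := fun q => by
    have := hτ0 q.2.2
    have h2 : (0 : ℝ) ≤ ((q.2.1 % m : ℕ) : ℝ) * L := by positivity
    simp only [x, hXdef]
    push_cast
    linarith
  have hxpos : ∀ q, 0 < x q := fun q => (hXpos _).trans_le (hxX q)
  have hx2X : ∀ q, q.2.2 < J → x q ≤ 2 * X q.1 := fun q hq => by
    have h1 := hL _ hq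
    have h2 : ((q.2.1 % m : ℕ) : ℝ) + 1 ≤ m := by exact_mod_cast Nat.mod_lt _ hm0
    have h3 := hX0 q.1
    have h4 : (((q.2.1 % m : ℕ) : ℝ) + 1) * L ≤ m * L := by gcongr
    simp only [x]
    have h5 : X q.1 = X₀ + q.1 * (m * L) := rfl
    push_cast at h4 ⊢
    linarith
  have hdist : ∀ q q', dist (W q).1 (W q').1 =
      ‖((x q - x q' : ℝ) : ℂ) + ((x q * ς q - x q' * ς q' : ℝ) : ℂ) * Complex.I‖ := fun q q' => by
    rw [dist_eq_norm, ← norm_neg]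
    have : -((W q).1 - (W q').1) = u * (((x q - x q' : ℝ) : ℂ) +
        ((x q * ς q - x q' * ς q' : ℝ) : ℂ) * Complex.I) := by
      simp only [W]
      push_cast
      ring
    rw [this, norm_mul, hu, one_mul]
  have hdre : ∀ q q', |x q - x q'| ≤ dist (W q).1 (W q').1 := fun q q' => by
    rw [hdist]
    refine le_trans (le_of_eq ?_) (Complex.abs_re_le_norm _)
    simp
  have hdim : ∀ q q', |x q * ς q - x q' * ς q'| ≤ dist (W q).1 (W q').1 := fun q q' => by
    rw [hdist]
    refine le_trans (le_of_eq ?_) (Complex.abs_im_le_norm _)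
    simp
  have hsep : ∀ q q', q.2.2 < J → q'.2.2 < J → q ≠ q' → D ≤ dist (W q).1 (W q').1 := by
    have hlt : ∀ q q', q.2.2 < J → q.1 * m + q.2.1 % m < q'.1 * m + q'.2.1 % m →
        D ≤ dist (W q).1 (W q').1 := by
      intro q q' hq h
      refine le_trans ?_ (hdre q q')
      rw [le_abs]
      right
      have h1 := hL _ hq
      have h2 := hτ0 q'.2.2
      have h3 : ((q.1 * m + q.2.1 % m : ℕ) : ℝ) + 1 ≤ ((q'.1 * m + q'.2.1 % m : ℕ) : ℝ) := by
        exact_mod_cast h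
      have h4 := mul_le_mul_of_nonneg_right h3 hL0.le
      simp only [x]
      linarith
    rintro q q' hq hq' hne
    -- Different sub-blocks are radially apart. Within one sub-block, different `j` are separated by
    -- `τ`, and equal `j` by the slope.
    rcases lt_trichotomy (q.1 * m + q.2.1 % m) (q'.1 * m + q'.2.1 % m) with h | h | h
    · exact hlt q q' hq h
    · obtain ⟨i, k, j⟩ := q
      obtain ⟨i', k', j'⟩ := q'
      simp only at h hq hq' hne
      have hk : k % m = k' % m := by
        have := congrArg (· % m) h
        simpa [Nat.add_mod] using this
      have hi : i = i' := by
        rw [hk] at h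
        exact Nat.eq_of_mul_eq_mul_right hm0 (Nat.add_right_cancel h)
      subst hi
      by_cases hj : j = j'
      · subst hj
        have hkk : k ≠ k' := fun hkk => hne (by rw [hkk])
        have hxx : x (i, k, j) = x (i, k', j) := by simp only [x, hk]
        refine le_trans ?_ (hdim _ _)
        rw [← hxx, ← mul_sub, abs_mul, abs_of_pos (hxpos _)]
        have h1 : ς (i, k, j) - ς (i, k', j) = (k - k' : ℝ) * (δ / 8) / X i := by
          simp only [ς]
          ring
        have h2 : (m : ℝ) ≤ |(k : ℝ) - k'| := by
          have h3 : (m : ℤ) ∣ (k : ℤ) - k' := (Nat.modEq_iff_dvd.1 (show k' ≡ k [MOD m] from hk.symm))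
          have h4 := Int.le_of_dvd (abs_pos.2 (sub_ne_zero.2 (by exact_mod_cast hkk)))
            ((dvd_abs _ _).2 h3)
          exact_mod_cast h4
        rw [h1, abs_div, abs_mul, abs_of_pos (hXpos i), abs_of_pos (by positivity : 0 < δ / 8)]
        have h5 : m * (δ / 8) ≤ |(k : ℝ) - k'| * (δ / 8) := by gcongr
        calc D ≤ |(k : ℝ) - k'| * (δ / 8) := hmD.trans h5
          _ = X i * (|(k : ℝ) - k'| * (δ / 8) / X i) := by
            field_simp [(hXpos i).ne']
          _ ≤ _ := by
            have := hXpos i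
            exact mul_le_mul_of_nonneg_right (hxX (i, k, j)) (by positivity)
      · refine le_trans ?_ (hdre _ _)
        have : x (i, k, j) - x (i, k', j') = τ j - τ j' := by
          simp only [x, hk]
          ring
        rw [this]
        exact hτ j j' hj
    · rw [dist_comm]
      exact hlt q' q hq' h
  refine ⟨(Finset.range I ×ˢ Finset.range K ×ˢ Finset.range J).image W, ?_, ?_, ?_, ?_⟩
  · simp only [Finset.forall_mem_image]
    intro q _
    have h1 : ‖(W q).1‖ = ‖(x q : ℂ) + ((x q * ς q : ℝ) : ℂ) * Complex.I‖ := by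
      have : (W q).1 = -(u * ((x q : ℂ) + ((x q * ς q : ℝ) : ℂ) * Complex.I)) := by
        simp only [W]
        push_cast
        ring
      rw [this, norm_neg, norm_mul, hu, one_mul]
    rw [h1]
    refine (hX₀R.trans ((hX0 q.1).trans (hxX q))).trans (le_trans ?_ (Complex.re_le_norm _))
    simp
  · simp only [Finset.forall_mem_image]
    intro q _
    have : ω q.2.2 ≠ 0 := norm_ne_zero_iff.1 (by rw [hω]; exact one_ne_zero)
    exact mul_ne_zero (by exact_mod_cast (Real.exp_pos _).ne') this
  · simp only [Finset.forall_mem_image]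
    intro q hq q' hq' hne
    simp only [Finset.mem_product, Finset.mem_range] at hq hq'
    exact hsep q q' hq.2.2 hq'.2.2 fun h => hne (by rw [h])
  rintro p hpI σ hσ b hb hbΛ
  have hp0 : 0 < p := hp₀.trans_le hpI.1
  set γ := Real.log ‖b‖ / p with hγ
  have hγB : |γ| ≤ B := by
    rw [hγ, abs_div, abs_of_pos hp0, hB]
    exact div_le_div₀ hΛ hbΛ hp₀ hpI.1
  obtain ⟨i, hiI, hci, hci'⟩ := exists_le_lt_succ c (x := γ)
    (by simpa [hc] using (abs_le.1 hγB).1) ((abs_le.1 hγB).2.trans_lt hI)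
  rw [hcsucc] at hci'
  have hXi := hXpos i
  set k := ⌊(σ + 1) / (δ / 8 / X i)⌋₊ with hk
  have hstep : 0 < δ / 8 / X i := by positivity
  have hσ0 : 0 ≤ (σ + 1) / (δ / 8 / X i) := div_nonneg (by linarith [hσ.1]) hstep.le
  have hk1 : k * (δ / 8 / X i) ≤ σ + 1 := (le_div_iff₀ hstep).1 (Nat.floor_le hσ0)
  have hk2 : σ + 1 < (k + 1) * (δ / 8 / X i) := (div_lt_iff₀ hstep).1 (Nat.lt_floor_add_one _)
  have hkK : k < K := by
    rw [hK, Nat.lt_succ_iff, ← Nat.cast_le (α := ℝ)]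
    refine le_trans ?_ (Nat.le_ceil _)
    rw [le_div_iff₀ (by positivity)]
    have h1 : k * (δ / 8) ≤ (σ + 1) * X i := by
      have := mul_le_mul_of_nonneg_right hk1 hXi.le
      have h2 : k * (δ / 8 / X i) * X i = k * (δ / 8) := by field_simp
      linarith
    have h2 : X i ≤ X I := hXmono hiI.le
    nlinarith [hσ.2]
  have hv : ‖b / (‖b‖ : ℂ)‖ = 1 := by
    rw [norm_div, Complex.norm_real, norm_norm, div_self (norm_ne_zero_iff.2 hb)]
  obtain ⟨j, hjJ, n, hn1, hn2⟩ := hhit p hpI (b / ‖b‖) hv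
    (X₀ + ((i * m + k % m : ℕ) : ℝ) * L) (by positivity)
  rw [sub_sub] at hn1
  change |n * p - x (i, k, j)| < δ₁ at hn1
  refine ⟨W (i, k, j), Finset.mem_image_of_mem _ ?_, n, ?_, ?_⟩
  · simp [hiI, hkK, hjJ]
  · have h1 : (W (i, k, j)).1 + n * (u * (p * (1 + σ * Complex.I))) =
        u * (((n * p - x (i, k, j) : ℝ) : ℂ) * (1 + σ * Complex.I) +
          ((x (i, k, j) * (σ - ς (i, k, j)) : ℝ) : ℂ) * Complex.I) := by
      simp only [W]
      push_cast
      ring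
    have h2 : |σ - ς (i, k, j)| ≤ δ / 8 / X i := by
      have : ς (i, k, j) = -1 + k * (δ / 8 / X i) := by
        simp only [ς]
        ring
      rw [this, abs_le]
      constructor <;> linarith
    have h3 : x (i, k, j) * |σ - ς (i, k, j)| ≤ δ / 4 := by
      calc x (i, k, j) * |σ - ς (i, k, j)| ≤ (2 * X i) * (δ / 8 / X i) :=
            mul_le_mul (hx2X (i, k, j) hjJ) h2 (abs_nonneg _) (by positivity)
        _ = δ / 4 := by
            field_simp
            norm_num
    have h4 : ‖(1 : ℂ) + σ * Complex.I‖ ≤ 2 := by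
      refine (norm_add_le _ _).trans ?_
      rw [norm_one, norm_mul, Complex.norm_I, mul_one, Complex.norm_real, Real.norm_eq_abs]
      have := abs_le.2 hσ
      linarith
    rw [h1, norm_mul, hu, one_mul]
    refine (norm_add_le _ _).trans_lt ?_
    rw [norm_mul, norm_mul, Complex.norm_I, mul_one, Complex.norm_real, Complex.norm_real,
      Real.norm_eq_abs, Real.norm_eq_abs, abs_mul, abs_of_pos (hxpos _)]
    have h5 : |n * p - x (i, k, j)| * ‖(1 : ℂ) + σ * Complex.I‖ ≤ δ₁ * 2 :=
      mul_le_mul hn1.le h4 (norm_nonneg _) hδ₁0.le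
    linarith
  · have hbpos : 0 < ‖b‖ := norm_pos_iff.2 hb
    set E := n * Real.log ‖b‖ - c i * x (i, k, j) with hE
    -- The first term is the error in hitting the radius, the second the rounding of `γ` down to `c
    -- i`, magnified by the radius.
    have hEeq : E = (n * p - x (i, k, j)) * γ + x (i, k, j) * (γ - c i) := by
      have : Real.log ‖b‖ = γ * p := by
        rw [hγ]
        field_simp
      rw [hE, this]
      ring
    have h1 : |E| ≤ 3 * δ / 16 := by
      rw [hEeq]
      refine (abs_add_le _ _).trans ?_
      rw [abs_mul, abs_mul, abs_of_pos (hxpos _), abs_of_nonneg (sub_nonneg.2 hci)]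
      have h2 : |n * p - x (i, k, j)| * |γ| ≤ δ₁ * B :=
        mul_le_mul hn1.le hγB (abs_nonneg _) hδ₁0.le
      have h3 : x (i, k, j) * (γ - c i) ≤ (2 * X i) * (δ / 16 * (X i)⁻¹) :=
        mul_le_mul (hx2X (i, k, j) hjJ) (by linarith) (sub_nonneg.2 hci) (by positivity)
      have h4 : (2 * X i) * (δ / 16 * (X i)⁻¹) = δ / 8 := by
        field_simp
        norm_num
      linarith
    have h2 : b ^ n * (W (i, k, j)).2 = (Real.exp E : ℂ) * ((b / ‖b‖) ^ n * ω j) := by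
      have h3 : Real.exp E = ‖b‖ ^ n * Real.exp (-(c i * x (i, k, j))) := by
        rw [hE, sub_eq_add_neg, Real.exp_add, Real.exp_nat_mul, Real.exp_log hbpos]
      have h4 : (‖b‖ : ℂ) ≠ 0 := by exact_mod_cast hbpos.ne'
      simp only [W]
      rw [h3, div_pow]
      push_cast
      field_simp
    rw [h2]
    refine (norm_mul_exp_sub_one_le (by linarith) ?_).trans_lt ?_
    · rw [norm_mul, norm_pow, hv, hω, one_pow, one_mul]
    · linarith

/-! ### The operators on the space of entire functions -/

theorem smul_translation_pow_apply (a b : ℂ) (n : ℕ) (f : EntireSpace) (z : ℂ) :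
    (((b • translation a) ^ n) f).1 z = b ^ n * f.1 (z - n * a) := by
  induction n generalizing z with
  | zero => simp
  | succ n ih =>
    rw [pow_succ', mul_apply_eq_comp]
    change b * (((b • translation a) ^ n) f).1 (z - a) = _
    rw [ih, pow_succ']
    push_cast
    rw [show z - a - n * a = z - (n + 1) * a by ring, mul_assoc]

theorem isClosed_entireFunctions : IsClosed (entireFunctions : Set C(ℂ, ℂ)) := by
  refine isClosed_of_closure_subset fun f hf => ?_
  have hne : (nhdsWithin f (entireFunctions : Set C(ℂ, ℂ))).NeBot :=
    mem_closure_iff_nhdsWithin_neBot.1 hf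
  have h1 : Filter.Tendsto (fun g : C(ℂ, ℂ) => g) (nhdsWithin f entireFunctions) (nhds f) :=
    nhdsWithin_le_nhds
  rw [ContinuousMap.tendsto_iff_tendstoLocallyUniformly] at h1
  have h2 : DifferentiableOn ℂ f Set.univ :=
    (tendstoLocallyUniformlyOn_univ.2 h1).differentiableOn
      (by
        filter_upwards [self_mem_nhdsWithin] with g hg
        exact (show Differentiable ℂ g from hg).differentiableOn) isOpen_univ
  exact differentiableOn_univ.1 h2

instance : BaireSpace EntireSpace := by
  have : CompleteSpace EntireSpace := isClosed_entireFunctions.completeSpace_coe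
  have : (uniformity EntireSpace).IsCountablyGenerated :=
    Filter.comap.isCountablyGenerated _ _
  infer_instance

instance : SecondCountableTopology EntireSpace :=
  TopologicalSpace.Subtype.secondCountableTopology (entireFunctions : Set C(ℂ, ℂ))

theorem exists_closedBall_approx_mem {W : Set EntireSpace} (hW : IsOpen W) {f : EntireSpace}
    (hf : f ∈ W) : ∃ R > 0, ∃ ε > 0, ∀ h : EntireSpace,
      (∀ z ∈ Metric.closedBall (0 : ℂ) R, ‖h.1 z - f.1 z‖ < ε) → h ∈ W := by
  obtain ⟨U, hU, rfl⟩ := isOpen_induced_iff.1 hW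
  have h1 := nhds_basis_uniformity' (x := f.1)
    (Metric.uniformity_basis_dist.compactConvergenceUniformity (α := ℂ) (β := ℂ))
  obtain ⟨⟨K, ε⟩, ⟨hK, hε⟩, hsub⟩ := h1.mem_iff.1 (hU.mem_nhds hf)
  obtain ⟨R, hR0, hR⟩ := hK.isBounded.subset_closedBall_lt 0 0
  refine ⟨R, hR0, ε, hε, fun h hh => hsub ?_⟩
  intro z hz
  have := hh z (hR hz)
  rw [← dist_eq_norm, dist_comm] at this
  exact this

/-- For fixed `n` the iterate is jointly continuous in the function and the parameters, so an `n`
that works at one parameter works nearby; compactness of `K` gives a common neighbourhood of `f`. -/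
theorem isOpen_forall_exists_pow_mem {K : Set (ℂ × ℂ)} (hK : IsCompact K) {V : Set EntireSpace}
    (hV : IsOpen V) :
    IsOpen {f : EntireSpace | ∀ q ∈ K, ∃ n : ℕ, ((q.2 • translation q.1) ^ n) f ∈ V} := by
  have hcont : ∀ n : ℕ, Continuous fun x : EntireSpace × (ℂ × ℂ) =>
      ((x.2.2 • translation x.2.1) ^ n) x.1 := by
    intro n
    refine continuous_induced_rng.2 (ContinuousMap.continuous_of_continuous_uncurry _ ?_)
    have h1 : Function.uncurry (fun (x : EntireSpace × (ℂ × ℂ)) (z : ℂ) =>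
        ((Subtype.val ∘ fun x : EntireSpace × (ℂ × ℂ) =>
          ((x.2.2 • translation x.2.1) ^ n) x.1) x : C(ℂ, ℂ)) z) =
        fun y : (EntireSpace × (ℂ × ℂ)) × ℂ => y.1.2.2 ^ n * y.1.1.1 (y.2 - n * y.1.2.1) := by
      funext y
      exact smul_translation_pow_apply _ _ _ _ _
    rw [h1]
    have h2 : Continuous fun y : (EntireSpace × (ℂ × ℂ)) × ℂ => y.1.1.1 (y.2 - n * y.1.2.1) :=
      ContinuousEval.continuous_eval.comp
        (Continuous.prodMk (continuous_subtype_val.comp (by fun_prop)) (by fun_prop))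
    fun_prop
  rw [isOpen_iff_eventually]
  intro f hf
  refine hK.eventually_forall_of_forall_eventually fun q hq => ?_
  obtain ⟨n, hn⟩ := hf q hq
  filter_upwards [(hcont n).continuousAt.preimage_mem_nhds (hV.mem_nhds (x := _) hn)] with x hx
  exact ⟨n, hx⟩

/-! ### Compact exhaustion of the parameters -/

/-- A compact set of parameters `(a, b)` with `a` in the quadrant around the direction `u`. -/
def quadrantParameters (u : ℂ) (N : ℕ) : Set (ℂ × ℂ) :=
  {q | (q.1 / u).re ∈ Set.Icc ((N + 1 : ℝ)⁻¹) (N + 1) ∧ |(q.1 / u).im| ≤ (q.1 / u).re ∧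
    ‖q.2‖ ∈ Set.Icc (Real.exp (-N)) (Real.exp N)}

theorem isCompact_quadrantParameters {u : ℂ} (hu : ‖u‖ = 1) (N : ℕ) :
    IsCompact (quadrantParameters u N) := by
  refine Metric.isCompact_of_isClosed_isBounded ?_ ?_
  · have h1 : Continuous fun q : ℂ × ℂ => (q.1 / u).re := by fun_prop
    have h2 : Continuous fun q : ℂ × ℂ => |(q.1 / u).im| := by fun_prop
    have h3 : Continuous fun q : ℂ × ℂ => ‖q.2‖ := by fun_prop
    exact (isClosed_Icc.preimage h1).inter
      ((isClosed_le h2 h1).inter (isClosed_Icc.preimage h3))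
  · refine ((Metric.isBounded_closedBall (x := (0 : ℂ)) (r := 2 * (N + 1))).prod
      (Metric.isBounded_closedBall (x := (0 : ℂ)) (r := Real.exp N))).subset ?_
    rintro ⟨a, b⟩ ⟨h1, h2, h3⟩
    refine ⟨?_, ?_⟩
    · rw [mem_closedBall_zero_iff]
      have h4 := Complex.norm_le_abs_re_add_abs_im (a / u)
      rw [norm_div, hu, div_one] at h4
      have h5 := abs_of_nonneg ((inv_nonneg.2 (by positivity : (0 : ℝ) ≤ N + 1)).trans h1.1)
      have h6 := h1.2
      simp only at h2 h4 h5 h6 ⊢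
      linarith
    · rw [mem_closedBall_zero_iff]
      exact h3.2

theorem exists_mem_quadrantParameters {a b : ℂ} (ha : a ≠ 0) (hb : b ≠ 0) :
    ∃ (k : Fin 4) (N : ℕ), (a, b) ∈ quadrantParameters (Complex.I ^ (k : ℕ)) N := by
  have key : ∀ u : ℂ, |(a / u).im| ≤ (a / u).re → u ≠ 0 → ∃ N, (a, b) ∈ quadrantParameters u N := by
    intro u h hu
    have hpos : 0 < (a / u).re := by
      refine lt_of_le_of_ne ((abs_nonneg _).trans h) fun h0 => div_ne_zero ha hu ?_
      rw [← h0] at h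
      exact Complex.ext h0.symm (by simpa using h)
    have hb' : 0 < ‖b‖ := norm_pos_iff.2 hb
    obtain ⟨N, hN⟩ := exists_nat_gt
      (max (max (a / u).re ((a / u).re)⁻¹) |Real.log ‖b‖|)
    simp only [max_lt_iff] at hN
    obtain ⟨⟨h1, h2⟩, h3⟩ := hN
    rw [abs_lt] at h3
    refine ⟨N, ⟨?_, ?_⟩, h, ?_, ?_⟩
    · exact inv_le_of_inv_le₀ hpos (by simp only; linarith)
    · simp only
      linarith
    · rw [← Real.le_log_iff_exp_le hb']
      exact h3.1.le
    · rw [← Real.log_le_iff_le_exp hb']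
      exact h3.2.le
  rcases le_total |a.im| |a.re| with h | h
  · rcases le_total 0 a.re with h0 | h0
    · rw [abs_of_nonneg h0] at h
      exact ⟨0, key _ (by simpa using h) (by simp)⟩
    · rw [abs_of_nonpos h0] at h
      exact ⟨2, key _ (by simpa [div_neg] using h) (by simp)⟩
  · rcases le_total 0 a.im with h0 | h0
    · rw [abs_of_nonneg h0] at h
      exact ⟨1, key _ (by simpa using h) (by simp)⟩
    · rw [abs_of_nonpos h0] at h
      exact ⟨3, key _ (by simpa [Complex.I_pow_three, div_neg] using h) (by simp)⟩

/-! ### Density and the Baire argument -/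

theorem dense_forall_exists_pow_mem {u : ℂ} (hu : ‖u‖ = 1) (N : ℕ) {V : Set EntireSpace}
    (hV : IsOpen V) (hVne : V.Nonempty) :
    Dense {f : EntireSpace | ∀ q ∈ quadrantParameters u N,
      ∃ n : ℕ, ((q.2 • translation q.1) ^ n) f ∈ V} := by
  classical
  rw [dense_iff_inter_open]
  rintro W hW ⟨f₀, hf₀⟩
  obtain ⟨g, hg⟩ := hVne
  obtain ⟨R₀, hR₀, ε₀, hε₀, hW'⟩ := exists_closedBall_approx_mem hW hf₀
  obtain ⟨R₁, hR₁, ε₁, hε₁, hV'⟩ := exists_closedBall_approx_mem hV hg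
  have hgd : Differentiable ℂ g.1 := g.2
  have hcomp : IsCompact (Metric.closedBall (0 : ℂ) (R₁ + 1)) := isCompact_closedBall _ _
  obtain ⟨δ₀, hδ₀, hδ₀'⟩ := Metric.uniformContinuousOn_iff.1
    (hcomp.uniformContinuousOn_of_continuous hgd.continuous.continuousOn) (ε₁ / 4) (by positivity)
  obtain ⟨G', hG'⟩ := hcomp.exists_bound_of_continuousOn hgd.continuous.continuousOn
  obtain ⟨G, hG0, hG⟩ : ∃ G > 0, ∀ z ∈ Metric.closedBall (0 : ℂ) (R₁ + 1), ‖g.1 z‖ ≤ G :=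
    ⟨max G' 1, lt_max_of_lt_right one_pos, fun z hz => (hG' z hz).trans (le_max_left _ _)⟩
  -- The three bounds keep the shifted argument within radius `R₁ + 1`, control the variation of `g`
  -- under the shift, and control the factor `b ^ n * x.2 - 1` times `g`.
  set δ := min 1 (min δ₀ (ε₁ / (4 * G))) with hδ
  have hδ0 : 0 < δ := by positivity
  have hδ1 : δ ≤ 1 := min_le_left _ _
  have hδ2 : δ ≤ δ₀ := (min_le_right _ _).trans (min_le_left _ _)
  have hδ3 : δ * G ≤ ε₁ / 4 := by
    have : δ ≤ ε₁ / (4 * G) := (min_le_right _ _).trans (min_le_right _ _)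
    rw [le_div_iff₀ (by positivity)] at this
    linarith
  have hN1 : (1 : ℝ) ≤ N + 1 := by simp
  obtain ⟨s, hs0, hsne, hsep, hcov⟩ := exists_separated_cover hu (R₀ + R₁ + 2)
    (p₀ := (N + 1 : ℝ)⁻¹) (p₁ := N + 1) (Λ := N) (by positivity)
    ((inv_le_one_of_one_le₀ hN1).trans hN1) (Nat.cast_nonneg _) hδ0 hδ1
    (D := 2 * (R₁ + 1) + 1) (by positivity)
  -- The approximation error near `x.1` gets multiplied by `‖b ^ n‖ ≤ 2 / ‖x.2‖`, so the tolerance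
  -- must scale with `‖x.2‖`.
  obtain ⟨η, ⟨hη1, hη2⟩, hη0⟩ : ∃ η : ℝ, (η ≤ ε₀ ∧ ∀ x ∈ s, η ≤ ε₁ / 8 * ‖x.2‖) ∧ 0 < η := by
    have h1 : ∀ᶠ η in nhdsWithin (0 : ℝ) (Set.Ioi 0), η ≤ ε₀ ∧ ∀ x ∈ s, η ≤ ε₁ / 8 * ‖x.2‖ := by
      refine Filter.Eventually.and ?_ ((Filter.eventually_all_finset s).2 fun x hx => ?_)
      · exact nhdsWithin_le_nhds (Iic_mem_nhds hε₀)
      · have : 0 < ‖x.2‖ := norm_pos_iff.2 (hsne x hx)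
        exact nhdsWithin_le_nhds (Iic_mem_nhds (by positivity))
    exact (h1.and self_mem_nhdsWithin).exists
  -- The index `none` is the central disc, where `f` imitates `f₀`; `some x` is the disc carrying
  -- the scaled translate of `g`.
  obtain ⟨f, hfd, hf⟩ := exists_entire_approx_on_closedBalls s.insertNone
    (fun i => i.elim 0 Prod.fst) (fun i => i.elim R₀ fun _ => R₁ + 1)
    (fun i _ => by cases i <;> simp <;> positivity)
    (by
      rintro (_ | x) hx (_ | y) hy hxy
      · exact absurd rfl hxy
      · have := hs0 y (by simpa using hy)
        simp only [Option.elim, dist_zero_left]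
        linarith
      · have := hs0 x (by simpa using hx)
        simp only [Option.elim, dist_zero_right]
        linarith
      · have := hsep x (by simpa using hx) y (by simpa using hy) fun h => hxy (by rw [h])
        simp only [Option.elim]
        linarith)
    (fun i => i.elim f₀.1 fun x z => x.2 * g.1 (z - x.1))
    (by
      rintro (_ | x) -
      · exact f₀.2
      · exact (hgd.comp (differentiable_id.sub_const x.1)).const_mul x.2) hη0
  let F : EntireSpace := ⟨⟨f, hfd.continuous⟩, hfd⟩
  refine ⟨F, hW' F fun z hz => (hf none (by simp) z hz).trans_le hη1, ?_⟩
  rintro ⟨a, b⟩ ⟨hp, hσ, hb⟩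
  simp only at hp hσ hb
  set p := (a / u).re with hpdef
  have hp0 : 0 < p := lt_of_lt_of_le (by positivity) hp.1
  have hune : u ≠ 0 := norm_ne_zero_iff.1 (by rw [hu]; exact one_ne_zero)
  have hbpos : 0 < ‖b‖ := (Real.exp_pos _).trans_le hb.1
  have ha : a = u * (p * (1 + ((a / u).im / p : ℝ) * Complex.I)) := by
    have h1 : a = u * ((p : ℂ) + (a / u).im * Complex.I) := by
      rw [hpdef, Complex.re_add_im]
      field_simp
    have h2 : (p : ℂ) ≠ 0 := by exact_mod_cast hp0.ne'
    conv_lhs => rw [h1]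
    push_cast
    field_simp
  obtain ⟨x, hxs, n, hn1, hn2⟩ := hcov p hp ((a / u).im / p)
    (abs_le.1 (by rw [abs_div, abs_of_pos hp0]; exact (div_le_one hp0).2 hσ)) b
    (norm_pos_iff.1 hbpos)
    (abs_le.2 ⟨(Real.le_log_iff_exp_le hbpos).2 hb.1, (Real.log_le_iff_le_exp hbpos).2 hb.2⟩)
  rw [← ha] at hn1
  refine ⟨n, hV' _ fun z hz => ?_⟩
  rw [smul_translation_pow_apply]
  change ‖b ^ n * f (z - n * a) - g.1 z‖ < ε₁
  rw [mem_closedBall_zero_iff] at hz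
  have hsub : z - n * a - x.1 = z - (x.1 + n * a) := by ring
  have hy : ‖z - n * a - x.1‖ ≤ R₁ + 1 := by
    rw [hsub]
    exact (norm_sub_le _ _).trans (by linarith)
  have h1 := hf (some x) (by simpa using hxs) (z - n * a)
    (by simpa [dist_eq_norm] using hy)
  simp only [Option.elim] at h1
  have h2 : ‖g.1 (z - n * a - x.1) - g.1 z‖ < ε₁ / 4 := by
    rw [← dist_eq_norm]
    refine hδ₀' _ (by simpa using hy) _ (by rw [mem_closedBall_zero_iff]; linarith) ?_
    rw [hsub, dist_eq_norm, sub_sub_cancel_left, norm_neg]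
    exact hn1.trans_le hδ2
  have h3 : ‖(b ^ n * x.2 - 1) * g.1 (z - n * a - x.1)‖ ≤ ε₁ / 4 := by
    rw [norm_mul]
    exact (mul_le_mul hn2.le (hG _ (by simpa using hy)) (norm_nonneg _) hδ0.le).trans hδ3
  have h4 : ‖b ^ n‖ * ‖x.2‖ ≤ 2 := by
    rw [← norm_mul]
    have := norm_add_le (b ^ n * x.2 - 1) 1
    rw [sub_add_cancel, norm_one] at this
    linarith
  have h5 : ‖b ^ n * (f (z - n * a) - x.2 * g.1 (z - n * a - x.1))‖ ≤ ε₁ / 4 := by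
    rw [norm_mul]
    calc _ ≤ ‖b ^ n‖ * (ε₁ / 8 * ‖x.2‖) :=
          mul_le_mul_of_nonneg_left (h1.le.trans (hη2 x hxs)) (norm_nonneg _)
      _ = ε₁ / 8 * (‖b ^ n‖ * ‖x.2‖) := by ring
      _ ≤ ε₁ / 8 * 2 := by gcongr
      _ = ε₁ / 4 := by ring
  have h6 : b ^ n * f (z - n * a) - g.1 z =
      b ^ n * (f (z - n * a) - x.2 * g.1 (z - n * a - x.1)) +
      (b ^ n * x.2 - 1) * g.1 (z - n * a - x.1) + (g.1 (z - n * a - x.1) - g.1 z) := by ring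
  rw [h6]
  refine (norm_add₃_le).trans_lt ?_
  linarith

/-- Four rotated sectors and an integer bound exhaust the parameters, and density need only be
tested on a countable basis; this makes the uncountable intersection countable. -/
theorem commonHypercyclicVectors_smul_translation_eq :
    (commonHypercyclicVectors fun p : {p : ℂ × ℂ // p.1 ≠ 0 ∧ p.2 ≠ 0} =>
        p.1.2 • translation p.1.1) =
      ⋂ i : {V : Set EntireSpace //
          V ∈ TopologicalSpace.countableBasis EntireSpace ∧ V.Nonempty} × Fin 4 × ℕ,
        {f : EntireSpace | ∀ q ∈ quadrantParameters (Complex.I ^ (i.2.1 : ℕ)) i.2.2,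
          ∃ n : ℕ, ((q.2 • translation q.1) ^ n) f ∈ i.1.1} := by
  ext f
  simp only [commonHypercyclicVectors, hypercyclicVectors, universalElements, Set.mem_iInter,
    Set.mem_ofPred_eq]
  constructor
  · rintro h ⟨⟨V, hV, hVne⟩, k, N⟩ q hq
    have hq1 : q.1 ≠ 0 := by
      intro h0
      have h1 := hq.1.1
      rw [h0, zero_div, Complex.zero_re] at h1
      exact absurd h1 (not_le.2 (by positivity))
    have hq2 : q.2 ≠ 0 := norm_pos_iff.1 ((Real.exp_pos _).trans_le hq.2.2.1)
    obtain ⟨_, hy, n, rfl⟩ := (h ⟨q, hq1, hq2⟩).inter_open_nonempty V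
      (TopologicalSpace.isOpen_of_mem_countableBasis hV) hVne
    exact ⟨n, hy⟩
  · rintro h ⟨⟨a, b⟩, ha, hb⟩
    obtain ⟨k, N, hkN⟩ := exists_mem_quadrantParameters ha hb
    refine (TopologicalSpace.isBasis_countableBasis EntireSpace).dense_iff.2 fun V hV hVne => ?_
    obtain ⟨n, hn⟩ := h ⟨⟨V, hV, hVne⟩, k, N⟩ (a, b) hkN
    exact ⟨_, hn, n, rfl⟩

theorem theorem1 :
    IsGδ (commonHypercyclicVectors fun p : {p : ℂ × ℂ // p.1 ≠ 0 ∧ p.2 ≠ 0} =>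
        p.1.2 • translation p.1.1) ∧
      Dense (commonHypercyclicVectors fun p : {p : ℂ × ℂ // p.1 ≠ 0 ∧ p.2 ≠ 0} =>
        p.1.2 • translation p.1.1) := by
  rw [commonHypercyclicVectors_smul_translation_eq]
  have : Countable {V : Set EntireSpace //
      V ∈ TopologicalSpace.countableBasis EntireSpace ∧ V.Nonempty} :=
    ((TopologicalSpace.countable_countableBasis EntireSpace).mono fun _ hV => hV.1).to_subtype
  have hu : ∀ k : Fin 4, ‖Complex.I ^ (k : ℕ)‖ = 1 := fun k => by simp
  have hopen := fun i : {V : Set EntireSpace //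
      V ∈ TopologicalSpace.countableBasis EntireSpace ∧ V.Nonempty} × Fin 4 × ℕ =>
    isOpen_forall_exists_pow_mem (isCompact_quadrantParameters (hu i.2.1) i.2.2)
      (TopologicalSpace.isOpen_of_mem_countableBasis i.1.2.1)
  exact ⟨IsGδ.iInter_of_isOpen hopen, dense_iInter_of_isOpen hopen fun i =>
    dense_forall_exists_pow_mem (hu i.2.1) i.2.2
      (TopologicalSpace.isOpen_of_mem_countableBasis i.1.2.1) i.1.2.2⟩
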